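/- Consider a committee of $N$ voters, $N$ odd, consisting of one expert $e$ and $N-1$ nonexperts. The state $\omega\in\{a,b\}$ has the flat prior $1/2$. Conditionally on $\omega$, the voters receive independent signals $s_i\in\{a,b\}$ with $\Pr(s_i=\omega\mid\omega)=q$ for each nonexpert $i$ and $\Pr(s_e=\omega\mid\omega)=r$ for the expert, where $1/2<q<r<1$; precisions are commonly known. Every voter is independent (there are no partisans), i.e. gets payoff $1$ if the election outcome matches the state and $0$ otherwise. The alternative with more votes is elected, with ties broken by a fair coin. In direct democracy (DD) a (pure) strategy of a voter maps her signal to a vote for $A$, a vote for $B$, or abstention. In liquid democracy (LD) it may also map it to the delegation of all votes she holds to another voter; delegation is transitive, and all votes held in a delegation cycle are cast in abstention. A voter votes sincerely if she votes according to her signal. An equilibrium is a Bayes Nash equilibrium in which no voter uses a weakly dominated strategy. An equilibrium is neutral if every voter either votes sincerely, or abstains at both signals, or delegates to the same voter at both signals. A best neutral equilibrium of a mechanism is one that maximizes, among its neutral equilibria, the probability that the outcome matches the state. Let $$w^*(e)=\frac{\log\bigl(r/(1-r)\bigr)}{\log\bigl(q/(1-q)\bigr)}.$$ Then LD has a best neutral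 equilibrium $\sigma$ such that: 1. if $w^*(e)<2$, all voters vote sincerely under $\sigma$; 2. if $w^*(e)\ge 2$, exactly $\min\{\lfloor w^*(e)\rfloor-1,\tfrac{N-1}{2}\}$ nonexperts delegate to the expert (at both signals) under $\sigma$, and all remaining voters (including the expert) vote sincerely. Moreover, DD has a best neutral equilibrium, and whenever $2<w^*(e)<\frac{N+1}{2}$, the best neutral equilibria of LD elect the correct alternative with strictly higher probability than the best neutral equilibria of DD. -/

import Mathlib

noncomputable section

namespace VoteDelegation

/-- States of nature, alternatives and signals are all encoded by `Bool`: `true` stands for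
`a` (alternative `A`) and `false` for `b` (alternative `B`). -/
abbrev Side := Bool

/-- Preferences of a voter: a partisan of an alternative, or an independent. -/
inductive Preference where
  | partisan (X : Side)
  | independent
  deriving DecidableEq

/-- Ex-post payoff `u_p(O, ω)` for the outcome `O` in the state `ω`. -/
def payoff (p : Preference) (O ω : Side) : ℝ :=
  match p with
  | .partisan X => if O = X then 1 else 0
  | .independent => if O = ω then 1 else 0

/-- What a voter can do with the votes she holds. -/
inductive Action (V : Type*) where
  | vote (X : Side)
  | abstain
  | delegate (j : V)
  deriving DecidableEq

/-- A pure interim strategy maps the private signal to an action. -/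
abbrev Strategy (V : Type*) := Side → Action V

/-- A strategy for every voter. -/
abbrev Profile (V : Type*) := V → Strategy V

/-- A committee whose types are publicly known. -/
structure Committee (V : Type*) where
  pref : V → Preference
  precision : V → ℝ
  /-- The prior probability of the state `a`. -/
  prior : ℝ

section Game

variable {V : Type*} [Fintype V] [DecidableEq V]

/-- One step along the delegations. -/
def follow (act : V → Action V) (i : V) : V :=
  match act i with
  | .delegate j => j
  | _ => i

/-- How the vote initially owned by `i` is finally cast. Delegation is transitive. If `i`'s chain
of delegations ends at a voter who does not delegate, it does so in fewer than `|V|` steps, and the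
vote is cast as that voter says; otherwise the chain is in a delegation cycle after `|V|`
steps, the value is then still a `delegate`, and the vote counts for neither alternative. -/
def castVote (act : V → Action V) (i : V) : Action V :=
  act ((follow act)^[Fintype.card V] i)

/-- The number of votes cast for the alternative `X`. -/
def votesFor (act : V → Action V) (X : Side) : ℕ :=
  (Finset.univ.filter fun i => castVote act i = Action.vote X).card

/-- The probability that `X` is elected: simple majority, ties broken by a fair coin. -/
def winProb (act : V → Action V) (X : Side) : ℝ :=
  if votesFor act (!X) < votesFor act X then 1
  else if votesFor act X = votesFor act (!X) then 1 / 2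
  else 0

/-- Prior probability of a state. -/
def stateProb (C : Committee V) (ω : Side) : ℝ :=
  if ω = true then C.prior else 1 - C.prior

/-- Probability of a signal profile in the state `ω`; signals are conditionally independent. -/
def signalProb (C : Committee V) (ω : Side) (s : V → Side) : ℝ :=
  ∏ i, if s i = ω then C.precision i else 1 - C.precision i

/-- The actions taken under `σ` at the signal profile `s`. -/
def actions (σ : Profile V) (s : V → Side) : V → Action V := fun i => σ i (s i)

/-- Expected utility of voter `i` under the strategy profile `σ`. -/
def expectedUtility (C : Committee V) (σ : Profile V) (i : V) : ℝ :=
  ∑ ω : Side, stateProb C ω * ∑ s : V → Side, signalProb C ω s *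
    ∑ O : Side, winProb (actions σ s) O * payoff (C.pref i) O ω

/-- The probability that the outcome matches the state under `σ`. -/
def correctProb (C : Committee V) (σ : Profile V) : ℝ :=
  ∑ ω : Side, stateProb C ω * ∑ s : V → Side, signalProb C ω s * winProb (actions σ s) ω

/-- A voting mechanism is given by the actions available to each voter. -/
abbrev Mechanism (V : Type*) := V → Set (Action V)

/-- Direct democracy: vote for `A`, vote for `B`, or abstain. -/
def directDemocracy : Mechanism V := fun _ => {x | ∀ j, x ≠ Action.delegate j}

/-- Liquid democracy: one may also delegate to any other voter. -/
def liquidDemocracy : Mechanism V := fun i => {x | x ≠ Action.delegate i}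

/-- `τ` is a strategy of voter `i` in the mechanism `M`. -/
def IsFeasible (M : Mechanism V) (i : V) (τ : Strategy V) : Prop := ∀ s, τ s ∈ M i

/-- `σ` is a strategy profile of the mechanism `M`. -/
def IsFeasibleProfile (M : Mechanism V) (σ : Profile V) : Prop := ∀ i, IsFeasible M i (σ i)

/-- `τ` is weakly dominated for voter `i`: some strategy of `i` does at least as well against all
strategies of the others, and strictly better against some. (`i`'s own entry of `σ` plays
no role.) -/
def IsWeaklyDominated (M : Mechanism V) (C : Committee V) (i : V) (τ : Strategy V) : Prop :=
  ∃ τ', IsFeasible M i τ' ∧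
    (∀ σ, IsFeasibleProfile M σ →
      expectedUtility C (Function.update σ i τ) i ≤ expectedUtility C (Function.update σ i τ') i) ∧
    ∃ σ, IsFeasibleProfile M σ ∧
      expectedUtility C (Function.update σ i τ) i < expectedUtility C (Function.update σ i τ') i

/-- Equilibrium: a Bayes Nash equilibrium in which no voter uses a weakly dominated strategy. -/
def IsEquilibrium (M : Mechanism V) (C : Committee V) (σ : Profile V) : Prop :=
  IsFeasibleProfile M σ ∧
    (∀ i τ, IsFeasible M i τ →
      expectedUtility C (Function.update σ i τ) i ≤ expectedUtility C σ i) ∧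
    ∀ i, ¬ IsWeaklyDominated M C i (σ i)

/-- Voting according to one's signal. -/
def IsSincere (τ : Strategy V) : Prop := ∀ s, τ s = Action.vote s

/-- Delegating to `j` at both signal realizations. -/
def DelegatesTo (τ : Strategy V) (j : V) : Prop := ∀ s, τ s = Action.delegate j

/-- Neutral strategies: sincere voting, abstaining at both signals, or delegating to the same
voter at both signals. -/
def IsNeutral (τ : Strategy V) : Prop :=
  IsSincere τ ∨ (∀ s, τ s = Action.abstain) ∨ ∃ j, DelegatesTo τ j

/-- An equilibrium in which all voters use neutral strategies. -/
def IsNeutralEquilibrium (M : Mechanism V) (C : Committee V) (σ : Profile V) : Prop :=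
  IsEquilibrium M C σ ∧ ∀ i, IsNeutral (σ i)

/-- A best neutral equilibrium has the largest probability of a correct outcome among all neutral
equilibria of the mechanism. -/
def IsBestNeutralEquilibrium (M : Mechanism V) (C : Committee V) (σ : Profile V) : Prop :=
  IsNeutralEquilibrium M C σ ∧
    ∀ σ', IsNeutralEquilibrium M C σ' → correctProb C σ' ≤ correctProb C σ

/-- The single expert committee: the expert `e` has precision `r`, all others have precision `q`,
all voters are independents, and the prior is flat. -/
def singleExpertCommittee (e : V) (q r : ℝ) : Committee V where
  pref := fun _ => Preference.independent
  precision := fun i => if i = e then r else q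
  prior := 1 / 2

end Game

/-- The relative optimal weight `w*(e)` of the expert. -/
def expertWeight (q r : ℝ) : ℝ := Real.log (r / (1 - r)) / Real.log (q / (1 - q))

end VoteDelegation

end

/-! All voters share one payoff, so every utility is `correctProb`, and a profile matters only
through its rule: the probability, given the signals, of electing the alternative the expert's
signal indicates. Accuracy is an increasing affine function of `value`, this probability summed
against `advantage`. Signals a rule ignores may be made uninformative (`value_restrict`); with the
signals of `e` and of a set M of nonexperts left, the advantage has the sign of w*(e) + |M| - 2 *
(number in M opposed to `e`) (`advantage_restrict_iff`). Rules can then be compared pointwise.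

Let the voters in M vote sincerely and all others delegate to `e`, who then casts N - |M| votes;
ties are impossible as N is odd. If N - |M| is the floor of w*(e), this is the Bayes rule for the
signals used; the cap (N + 1) / 2 is where `e` already decides alone. Let m be the resulting size of
M. A neutral profile uses, besides `e`, only the signals of its sincere nonexperts. If they number
at most m, extra signals can only help. If they are more, the expert has too little weight, a
hostile strict majority among them cannot be overruled, and each further voter handed over to `e` is
no loss (`exists_optimalSize_value_le`). The same comparisons exclude deviations
(`delegationProfile_isEquilibrium`).

In direct democracy the expert has weight at most one. If w*(e) > 2, shifting weight to her strictly
improves the rule, within the class beaten by delegation; when she votes alone, delegation wins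
because M sometimes rightly overrules her (`weightRule_le_one_lt_delegationRule`). -/

namespace VoteDelegation

open Finset

/-! ### Accuracy of a rule and the sign of the likelihood difference -/

section Value

variable {V : Type*} [Fintype V] [DecidableEq V]

/-- A function of the signal profile depends only on the signals of the voters in `T`. -/
def DependsOnlyOn (T : Finset V) (f : (V → Side) → ℝ) : Prop :=
  ∀ s t : V → Side, (∀ i ∈ T, s i = t i) → f s = f t

omit [Fintype V] [DecidableEq V] in
theorem DependsOnlyOn.mono {T U : Finset V} {f : (V → Side) → ℝ} (h : DependsOnlyOn T f)
    (hTU : T ⊆ U) : DependsOnlyOn U f :=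
  fun s t hst => h s t fun i hi => hst i (hTU hi)

/-- The signal profile with the signal of `i` reversed. -/
def flipSignal (i : V) : (V → Side) ≃ (V → Side) where
  toFun s := Function.update s i (!s i)
  invFun s := Function.update s i (!s i)
  left_inv s := by simp
  right_inv s := by simp

/-- Pairing each signal profile with its flip at `i` sums the factor of `i` to `p i + (1 - p i) =
1`, so the precision of `i` drops out. -/
theorem sum_mul_signalProb_update (C : Committee V) (ω : Side) (i : V) (x : ℝ)
    (f : (V → Side) → ℝ) (hf : ∀ s, f (flipSignal i s) = f s) :
    ∑ s, f s * signalProb C ω s =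
      ∑ s, f s * signalProb { C with precision := Function.update C.precision i x } ω s := by
  have key : ∀ p : V → ℝ, (∑ s, f s * signalProb { C with precision := p } ω s) * 2 =
      ∑ s, f s * ∏ j ∈ univ.erase i, if s j = ω then p j else 1 - p j := by
    intro p
    have h1 := Equiv.sum_comp (flipSignal i)
      (fun s => f s * signalProb { C with precision := p } ω s)
    rw [mul_two]
    nth_rewrite 1 [← h1]
    rw [← sum_add_distrib]
    refine sum_congr rfl fun s _ => ?_
    simp only [hf, signalProb]
    rw [← mul_prod_erase univ _ (mem_univ i), ← mul_prod_erase univ _ (mem_univ i)]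
    have h2 : ∏ j ∈ univ.erase i, (if flipSignal i s j = ω then p j else 1 - p j) =
        ∏ j ∈ univ.erase i, if s j = ω then p j else 1 - p j := by
      refine prod_congr rfl fun j hj => ?_
      have hji : j ≠ i := ne_of_mem_erase hj
      simp [flipSignal, hji]
    rw [h2]
    have h3 : (if flipSignal i s i = ω then p i else 1 - p i) +
        (if s i = ω then p i else 1 - p i) = 1 := by
      simp only [flipSignal, Equiv.coe_fn_mk, Function.update_self]
      cases s i <;> cases ω <;> simp
    rw [← mul_add, ← add_mul, h3, one_mul]
  have h1 := key C.precision
  have h2 := key (Function.update C.precision i x)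
  have h3 : (∑ s, f s * ∏ j ∈ univ.erase i, if s j = ω then C.precision j else 1 - C.precision j) =
      ∑ s, f s * ∏ j ∈ univ.erase i,
        if s j = ω then Function.update C.precision i x j
          else 1 - Function.update C.precision i x j := by
    refine sum_congr rfl fun s _ => ?_
    congr 1
    refine prod_congr rfl fun j hj => ?_
    rw [Function.update_of_ne (ne_of_mem_erase hj)]
  have h4 : ({ C with precision := C.precision } : Committee V) = C := rfl
  rw [h4] at h1
  linarith

/-- The committee in which the signals of the voters outside `T` are uninformative. -/
noncomputable def Committee.restrict (C : Committee V) (T : Finset V) : Committee V :=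
  { C with precision := fun i => if i ∈ T then C.precision i else 1 / 2 }

/-- The voters outside `T` are neutralized one at a time. The restricted committee thus replaces
conditioning on the signals in `T`. -/
theorem sum_mul_signalProb_restrict (C : Committee V) (ω : Side) (T : Finset V)
    (f : (V → Side) → ℝ) (hf : DependsOnlyOn T f) :
    ∑ s, f s * signalProb C ω s = ∑ s, f s * signalProb (C.restrict T) ω s := by
  have key : ∀ U : Finset V, Disjoint U T → ∑ s, f s * signalProb C ω s =
      ∑ s, f s * signalProb (C.restrict Uᶜ) ω s := by
    intro U
    induction U using Finset.induction_on with
    | empty => intro _; simp [Committee.restrict]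
    | insert i U hi ih =>
      intro hd
      rw [disjoint_insert_left] at hd
      rw [ih hd.2, sum_mul_signalProb_update (C.restrict Uᶜ) ω i (1 / 2) f]
      · have : ({ C.restrict Uᶜ with
            precision := Function.update (C.restrict Uᶜ).precision i (1 / 2) } : Committee V) =
            C.restrict (insert i U)ᶜ := by
          simp only [Committee.restrict, Committee.mk.injEq, true_and, and_true]
          funext j
          by_cases hj : j = i
          · subst hj; simp
          · simp [hj]
        rw [this]
      · intro s
        refine hf _ _ fun j hj => ?_
        have hji : j ≠ i := fun h => hd.1 (h ▸ hj)
        simp [flipSignal, hji]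
  simpa using key Tᶜ disjoint_compl_left

/-- How much likelier the signal profile is in the state indicated by the signal of `c` than in
the other state. -/
noncomputable def advantage (C : Committee V) (c : V) (s : V → Side) : ℝ :=
  signalProb C (s c) s - signalProb C (!s c) s

/-- The gain in accuracy, up to normalization, from following the signal of `c` with
probability `φ`. -/
noncomputable def value (C : Committee V) (c : V) (φ : (V → Side) → ℝ) : ℝ :=
  ∑ s, φ s * advantage C c s

theorem value_restrict (C : Committee V) (c : V) (T : Finset V) (hc : c ∈ T)
    (φ : (V → Side) → ℝ) (hφ : DependsOnlyOn T φ) :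
    value C c φ = value (C.restrict T) c φ := by
  -- The advantage refers to the state `s c`, which varies with `s`. Splitting by true state leaves
  -- coefficients that depend only on `T`, since `c ∈ T`.
  have key : ∀ D : Committee V, value D c φ =
      ∑ s, (if s c = true then φ s else -φ s) * signalProb D true s +
      ∑ s, (if s c = true then -φ s else φ s) * signalProb D false s := by
    intro D
    rw [value, ← sum_add_distrib]
    refine sum_congr rfl fun s _ => ?_
    cases h : s c <;> simp [advantage, h] <;> ring
  rw [key, key, sum_mul_signalProb_restrict C true T, sum_mul_signalProb_restrict C false T]
  all_goals
    intro s t hst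
    simp only [hst c hc, hφ s t hst]

theorem value_le_value {C : Committee V} {c : V} {T : Finset V} (hc : c ∈ T)
    {φ ψ : (V → Side) → ℝ} (hφ : DependsOnlyOn T φ) (hψ : DependsOnlyOn T ψ)
    (h : ∀ s, φ s * advantage (C.restrict T) c s ≤ ψ s * advantage (C.restrict T) c s) :
    value C c φ ≤ value C c ψ := by
  rw [value_restrict C c T hc φ hφ, value_restrict C c T hc ψ hψ]
  exact sum_le_sum fun s _ => h s

theorem value_lt_value {C : Committee V} {c : V} {T : Finset V} (hc : c ∈ T)
    {φ ψ : (V → Side) → ℝ} (hφ : DependsOnlyOn T φ) (hψ : DependsOnlyOn T ψ)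
    (h : ∀ s, φ s * advantage (C.restrict T) c s ≤ ψ s * advantage (C.restrict T) c s)
    (s₀ : V → Side)
    (h₀ : φ s₀ * advantage (C.restrict T) c s₀ < ψ s₀ * advantage (C.restrict T) c s₀) :
    value C c φ < value C c ψ := by
  rw [value_restrict C c T hc φ hφ, value_restrict C c T hc ψ hψ]
  exact sum_lt_sum (fun s _ => h s) ⟨s₀, mem_univ _, h₀⟩

/-- The number of voters in `M` whose signal differs from that of `c`. -/
def opposed (c : V) (M : Finset V) (s : V → Side) : ℕ := (M.filter fun i => s i ≠ s c).card

omit [Fintype V] [DecidableEq V] in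
theorem opposed_le_card (c : V) (M : Finset V) (s : V → Side) : opposed c M s ≤ M.card :=
  card_filter_le _ _

theorem signalProb_restrict (C : Committee V) (c : V) (M : Finset V) (hcM : c ∉ M) (q : ℝ)
    (hM : ∀ i ∈ M, C.precision i = q) (s : V → Side) :
    signalProb (C.restrict (insert c M)) (s c) s =
        C.precision c * (q ^ (M.card - opposed c M s) * (1 - q) ^ opposed c M s) *
          (1 / 2) ^ (insert c M)ᶜ.card ∧
      signalProb (C.restrict (insert c M)) (!s c) s =
        (1 - C.precision c) * ((1 - q) ^ (M.card - opposed c M s) * q ^ opposed c M s) *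
          (1 / 2) ^ (insert c M)ᶜ.card := by
  have hcard : (M.filter fun i => s i = s c).card = M.card - opposed c M s := by
    have := card_filter_add_card_filter_not (s := M) (fun i => s i = s c)
    simp only [opposed, ne_eq]
    omega
  have hsplit : ∀ ω : Side, signalProb (C.restrict (insert c M)) ω s =
      (if s c = ω then C.precision c else 1 - C.precision c) *
        (∏ i ∈ M, if s i = ω then q else 1 - q) * (1 / 2) ^ (insert c M)ᶜ.card := by
    intro ω
    rw [signalProb, ← prod_mul_prod_compl (insert c M), prod_insert hcM]
    congr 1
    · congr 1
      · simp [Committee.restrict]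
      · refine prod_congr rfl fun i hi => ?_
        simp [Committee.restrict, hi, hM i hi]
    · rw [← prod_const]
      refine prod_congr rfl fun i hi => ?_
      rw [mem_compl] at hi
      simp only [Committee.restrict, hi, if_false]
      split_ifs <;> norm_num
  constructor
  · rw [hsplit, if_pos rfl, prod_ite, prod_const, prod_const, hcard]
    rfl
  · have hne : ∀ i, s i = !s c ↔ ¬ s i = s c := by
      intro i; cases s i <;> cases s c <;> simp
    rw [hsplit, if_neg (by cases s c <;> simp), prod_ite, prod_const, prod_const]
    simp only [hne, not_not, hcard]
    rw [mul_comm (q ^ _)]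
    rfl

/-- The log-likelihood ratio is `(expertWeight q p + M.card - 2 * o) * log (q / (1 - q))`, where `p`
is the precision of `c` and `o` counts the opposed voters: each agreeing voter adds one unit, each
opposed voter removes one. -/
theorem advantage_restrict_iff (C : Committee V) (c : V) (M : Finset V) (hcM : c ∉ M) (q : ℝ)
    (hM : ∀ i ∈ M, C.precision i = q) (hq : 1 / 2 < q) (hq1 : q < 1)
    (hc0 : 0 < C.precision c) (hc1 : C.precision c < 1) (s : V → Side) :
    (0 < advantage (C.restrict (insert c M)) c s ↔
        2 * (opposed c M s : ℝ) < expertWeight q (C.precision c) + M.card) ∧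
      (0 ≤ advantage (C.restrict (insert c M)) c s ↔
        2 * (opposed c M s : ℝ) ≤ expertWeight q (C.precision c) + M.card) := by
  obtain ⟨h1, h2⟩ := signalProb_restrict C c M hcM q hM s
  have hle := opposed_le_card c M s
  set o := opposed c M s
  set k := M.card - o with hk
  have hcast : (M.card : ℝ) = k + o := by rw [← Nat.cast_add]; congr 1; omega
  set p := C.precision c
  have hH : (0 : ℝ) < (1 / 2) ^ (insert c M)ᶜ.card := by positivity
  have hq0 : 0 < q := by linarith
  have hq2 : 0 < 1 - q := by linarith
  have hp2 : 0 < 1 - p := by linarith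
  have hlq : 0 < Real.log (q / (1 - q)) := Real.log_pos (by rw [lt_div_iff₀ hq2]; linarith)
  have hx : 0 < p * (q ^ k * (1 - q) ^ o) := by positivity
  have hy : 0 < (1 - p) * ((1 - q) ^ k * q ^ o) := by positivity
  have hlx : Real.log (p * (q ^ k * (1 - q) ^ o)) =
      Real.log p + (k * Real.log q + o * Real.log (1 - q)) := by
    rw [Real.log_mul hc0.ne' (by positivity), Real.log_mul (by positivity) (by positivity),
      Real.log_pow, Real.log_pow]
  have hly : Real.log ((1 - p) * ((1 - q) ^ k * q ^ o)) =
      Real.log (1 - p) + (k * Real.log (1 - q) + o * Real.log q) := by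
    rw [Real.log_mul hp2.ne' (by positivity), Real.log_mul (by positivity) (by positivity),
      Real.log_pow, Real.log_pow]
  have hw : expertWeight q p * (Real.log q - Real.log (1 - q)) =
      Real.log p - Real.log (1 - p) := by
    rw [expertWeight, ← Real.log_div hq0.ne' hq2.ne', ← Real.log_div hc0.ne' hp2.ne']
    field_simp
  have hlq' : 0 < Real.log q - Real.log (1 - q) := by
    rw [← Real.log_div hq0.ne' hq2.ne']; exact hlq
  have hdiff : Real.log (p * (q ^ k * (1 - q) ^ o)) - Real.log ((1 - p) * ((1 - q) ^ k * q ^ o)) =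
      (expertWeight q p + M.card - 2 * o) * (Real.log q - Real.log (1 - q)) := by
    rw [hlx, hly, hcast]; linear_combination -hw
  rw [advantage, h1, h2, ← sub_mul]
  constructor
  · rw [mul_pos_iff_of_pos_right hH, sub_pos, ← Real.log_lt_log_iff hy hx, ← sub_pos, hdiff,
      mul_pos_iff_of_pos_right hlq', sub_pos]
  · rw [mul_nonneg_iff_of_pos_right hH, sub_nonneg, ← Real.log_le_log_iff hy hx, ← sub_nonneg,
      hdiff, mul_nonneg_iff_of_pos_right hlq', sub_nonneg]

end Value

/-! ### Comparison of delegation rules and weighted majority rules -/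

section Rules

variable {V : Type*} [Fintype V] [DecidableEq V]

theorem expert_advantage_iff {e : V} {q r : ℝ} (hq : 1 / 2 < q) (hqr : q < r) (hr : r < 1)
    {M : Finset V} (heM : e ∉ M) (s : V → Side) :
    (0 < advantage ((singleExpertCommittee e q r).restrict (insert e M)) e s ↔
        2 * (opposed e M s : ℝ) < expertWeight q r + M.card) ∧
      (0 ≤ advantage ((singleExpertCommittee e q r).restrict (insert e M)) e s ↔
        2 * (opposed e M s : ℝ) ≤ expertWeight q r + M.card) := by
  have h := advantage_restrict_iff (singleExpertCommittee e q r) e M heM q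
    (fun i hi => by
      have : i ≠ e := fun h => heM (h ▸ hi)
      simp [singleExpertCommittee, this]) hq (hqr.trans hr)
    (by simp [singleExpertCommittee]; linarith) (by simpa [singleExpertCommittee] using hr) s
  simpa [singleExpertCommittee] using h

theorem one_lt_expertWeight {q r : ℝ} (hq : 1 / 2 < q) (hqr : q < r) (hr : r < 1) :
    1 < expertWeight q r := by
  have hq2 : 0 < 1 - q := by linarith
  have hr2 : 0 < 1 - r := by linarith
  have h1 : 1 < q / (1 - q) := by rw [lt_div_iff₀ hq2]; linarith
  rw [expertWeight, one_lt_div (Real.log_pos h1)]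
  refine Real.log_lt_log (by linarith) ?_
  rw [div_lt_div_iff₀ hq2 hr2]
  nlinarith

omit [Fintype V] [DecidableEq V] in
theorem opposed_congr {e : V} {M : Finset V} {s t : V → Side} (he : s e = t e)
    (h : ∀ i ∈ M, s i = t i) : opposed e M s = opposed e M t := by
  unfold opposed
  congr 1
  refine filter_congr fun i hi => ?_
  rw [h i hi, he]

omit [Fintype V] in
theorem opposed_insert {e j : V} {M : Finset V} (hj : j ∉ M) (s : V → Side) :
    opposed e (insert j M) s = opposed e M s + if s j ≠ s e then 1 else 0 := by
  unfold opposed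
  rw [filter_insert]
  split_ifs with h
  · rw [card_insert_of_notMem (by simp [hj])]
  · rfl

omit [Fintype V] in
theorem exists_opposed_eq {e : V} {M : Finset V} (heM : e ∉ M) {n : ℕ} (hn : n ≤ M.card) :
    ∃ s : V → Side, opposed e M s = n := by
  obtain ⟨O, hO, hcard⟩ := exists_subset_card_eq hn
  refine ⟨fun i => decide (i ∉ O), ?_⟩
  have heO : e ∉ O := fun h => heM (hO h)
  rw [opposed, ← hcard]
  congr 1
  ext i
  simp only [mem_filter, heO, not_false_eq_true, decide_true, ne_eq, decide_eq_true_eq, not_not]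
  exact ⟨fun h => h.2, fun h => ⟨hO h, h⟩⟩

/-- The probability of following `e` when all voters outside `M` delegate to `e`. -/
noncomputable def delegationRule (e : V) (M : Finset V) (s : V → Side) : ℝ :=
  if Fintype.card V < 2 * opposed e M s then 0 else 1

/-- The probability of following `e` when `e` has weight `k`, the voters in `M` have weight one,
and nobody else votes. -/
noncomputable def weightRule (e : V) (k : ℕ) (M : Finset V) (s : V → Side) : ℝ :=
  if 2 * opposed e M s < k + M.card then 1
  else if 2 * opposed e M s = k + M.card then 1 / 2 else 0

/-- Rules using only the signals of `e` and of the voters in `M`, which do not follow `e` against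
a majority of the committee within `M`. -/
structure IsAdmissible (e : V) (M : Finset V) (φ : (V → Side) → ℝ) : Prop where
  nonneg : ∀ s, 0 ≤ φ s
  le_one : ∀ s, φ s ≤ 1
  dependsOnlyOn : DependsOnlyOn (insert e M) φ
  majority : ∀ s, Fintype.card V < 2 * opposed e M s → φ s = 0

theorem delegationRule_isAdmissible (e : V) (M : Finset V) :
    IsAdmissible e M (delegationRule e M) where
  nonneg s := by unfold delegationRule; split_ifs <;> norm_num
  le_one s := by unfold delegationRule; split_ifs <;> norm_num
  dependsOnlyOn s t h := by
    unfold delegationRule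
    rw [opposed_congr (h e (mem_insert_self _ _)) fun i hi => h i (mem_insert_of_mem hi)]
  majority s h := by rw [delegationRule, if_pos h]

theorem weightRule_isAdmissible (e : V) {k : ℕ} {M : Finset V}
    (hk : k + M.card ≤ Fintype.card V) : IsAdmissible e M (weightRule e k M) where
  nonneg s := by unfold weightRule; split_ifs <;> norm_num
  le_one s := by unfold weightRule; split_ifs <;> norm_num
  dependsOnlyOn s t h := by
    unfold weightRule
    rw [opposed_congr (h e (mem_insert_self _ _)) fun i hi => h i (mem_insert_of_mem hi)]
  majority s h := by rw [weightRule, if_neg (by omega), if_neg (by omega)]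

/-- If the precision of the expert is high enough to justify her weight under the delegation rule,
that rule beats all rules that use more signals but agree with it when it goes against her. -/
theorem value_le_delegationRule {e : V} {q r : ℝ} (hq : 1 / 2 < q) (hqr : q < r) (hr : r < 1)
    {M M' : Finset V} (heM' : e ∉ M') (hMM' : M ⊆ M') {φ : (V → Side) → ℝ}
    (hle : ∀ s, φ s ≤ 1) (hφ : DependsOnlyOn (insert e M') φ)
    (hmaj : ∀ s, Fintype.card V < 2 * opposed e M s → φ s = 0)
    (hadv : ∀ s, 2 * opposed e M s ≤ Fintype.card V →
      2 * (opposed e M' s : ℝ) ≤ expertWeight q r + M'.card) :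
    value (singleExpertCommittee e q r) e φ ≤
      value (singleExpertCommittee e q r) e (delegationRule e M) := by
  refine value_le_value (mem_insert_self e M') hφ
    ((delegationRule_isAdmissible e M).dependsOnlyOn.mono (insert_subset_insert _ hMM'))
    fun s => ?_
  unfold delegationRule
  split_ifs with h
  · rw [hmaj s h]
  · exact mul_le_mul_of_nonneg_right (hle s)
      ((expert_advantage_iff hq hqr hr heM' s).2.2 (hadv s (by omega)))

/-- `m` voters besides the expert is the right number for the delegation rule: with `N - m` votes
the expert's weight is optimal, or at most optimal and she is decisive. -/
structure IsOptimalSize (N : ℕ) (W : ℝ) (m : ℕ) : Prop where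
  lt : m < N
  le_weight : (N : ℝ) ≤ W + m
  weight_le : W + m < N + 1 ∨ 2 * m < N

/-- The rule takes the Bayes decision at every signal profile. A hostile majority means `2 * o ≥ N +
1`, which exceeds the expert's weight plus `M.card`, or is impossible when `M` is too small to form
one. -/
theorem delegationRule_optimal {e : V} {q r : ℝ} (hq : 1 / 2 < q) (hqr : q < r) (hr : r < 1)
    {M : Finset V} (heM : e ∉ M)
    (hM : IsOptimalSize (Fintype.card V) (expertWeight q r) M.card) (s : V → Side) :
    (Fintype.card V < 2 * opposed e M s ∧ delegationRule e M s = 0 ∧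
      advantage ((singleExpertCommittee e q r).restrict (insert e M)) e s < 0) ∨
    (delegationRule e M s = 1 ∧
      0 ≤ advantage ((singleExpertCommittee e q r).restrict (insert e M)) e s) := by
  obtain ⟨-, h1, h2⟩ := hM
  have hop := opposed_le_card e M s
  unfold delegationRule
  split_ifs with h
  · refine Or.inl ⟨h, rfl, ?_⟩
    rw [← not_le, (expert_advantage_iff hq hqr hr heM s).2, not_le]
    rcases h2 with h2 | h2
    · have : ((Fintype.card V + 1 : ℕ) : ℝ) ≤ ((2 * opposed e M s : ℕ) : ℝ) := by
        exact_mod_cast h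
      push_cast at this
      linarith
    · omega
  · refine Or.inr ⟨rfl, (expert_advantage_iff hq hqr hr heM s).2.2 ?_⟩
    have : ((2 * opposed e M s : ℕ) : ℝ) ≤ (Fintype.card V : ℝ) := by exact_mod_cast not_lt.1 h
    push_cast at this
    linarith

theorem mul_advantage_le_delegationRule {e : V} {q r : ℝ} (hq : 1 / 2 < q) (hqr : q < r)
    (hr : r < 1) {M : Finset V} (heM : e ∉ M)
    (hM : IsOptimalSize (Fintype.card V) (expertWeight q r) M.card) {x : ℝ} (hx0 : 0 ≤ x)
    (hx1 : x ≤ 1) (s : V → Side) :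
    x * advantage ((singleExpertCommittee e q r).restrict (insert e M)) e s ≤
      delegationRule e M s *
        advantage ((singleExpertCommittee e q r).restrict (insert e M)) e s := by
  rcases delegationRule_optimal hq hqr hr heM hM s with ⟨-, h1, h2⟩ | ⟨h1, h2⟩
  · rw [h1]; nlinarith
  · rw [h1]; nlinarith

theorem value_le_of_isOptimalSize {e : V} {q r : ℝ} (hq : 1 / 2 < q) (hqr : q < r) (hr : r < 1)
    {M : Finset V} (heM : e ∉ M)
    (hM : IsOptimalSize (Fintype.card V) (expertWeight q r) M.card) {φ : (V → Side) → ℝ}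
    (h0 : ∀ s, 0 ≤ φ s) (h1 : ∀ s, φ s ≤ 1) (hφ : DependsOnlyOn (insert e M) φ) :
    value (singleExpertCommittee e q r) e φ ≤
      value (singleExpertCommittee e q r) e (delegationRule e M) :=
  value_le_value (mem_insert_self e M) hφ (delegationRule_isAdmissible e M).dependsOnlyOn
    fun s => mul_advantage_le_delegationRule hq hqr hr heM hM (h0 s) (h1 s) s

/-- By parity, the two rules differ only when `j` completes a bare majority of (N + 1) / 2 against
`e`; there the weight bound still favors `e`. -/
theorem value_delegationRule_insert_le {e : V} (hN : Odd (Fintype.card V)) {q r : ℝ}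
    (hq : 1 / 2 < q) (hqr : q < r) (hr : r < 1) {M : Finset V} {j : V} (hj : j ∉ M)
    (heM : e ∉ insert j M) (hM : (Fintype.card V : ℝ) ≤ expertWeight q r + M.card) :
    value (singleExpertCommittee e q r) e (delegationRule e (insert j M)) ≤
      value (singleExpertCommittee e q r) e (delegationRule e M) := by
  refine value_le_delegationRule hq hqr hr heM (subset_insert j M)
    (delegationRule_isAdmissible e _).le_one (delegationRule_isAdmissible e _).dependsOnlyOn
    (fun s hs => ?_) fun s hs => ?_
  · rw [delegationRule, if_pos]
    rw [opposed_insert hj]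
    omega
  · have h1 : opposed e (insert j M) s ≤ opposed e M s + 1 := by
      rw [opposed_insert hj]; split_ifs <;> omega
    have h2 : 2 * opposed e (insert j M) s ≤ Fintype.card V + 1 := by
      obtain ⟨k, hk⟩ := hN
      omega
    have h3 : (2 * opposed e (insert j M) s : ℝ) ≤ (Fintype.card V : ℝ) + 1 := by exact_mod_cast h2
    rw [card_insert_of_notMem hj]
    push_cast
    linarith

theorem exists_optimalSize_value_le {e : V} (hN : Odd (Fintype.card V)) {q r : ℝ}
    (hq : 1 / 2 < q) (hqr : q < r) (hr : r < 1) {m : ℕ}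
    (hm : IsOptimalSize (Fintype.card V) (expertWeight q r) m) {M : Finset V} (heM : e ∉ M)
    {φ : (V → Side) → ℝ} (hφ : IsAdmissible e M φ) :
    ∃ M' : Finset V, e ∉ M' ∧ M'.card = m ∧ value (singleExpertCommittee e q r) e φ ≤
      value (singleExpertCommittee e q r) e (delegationRule e M') := by
  -- A small `M` is enlarged to size `m`, where the delegation rule is Bayes optimal for the larger
  -- set of signals. A large `M` loses its voters one by one, after `φ` is replaced by the
  -- delegation rule of `M`.
  rcases le_total M.card m with hle | hle
  · have hcard : m ≤ (univ.erase e).card := by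
      rw [card_erase_of_mem (mem_univ e), card_univ]
      have := hm.lt
      omega
    obtain ⟨M', hMM', hM'e, hM'⟩ := exists_subsuperset_card_eq
      (fun i hi => mem_erase.2 ⟨fun h => heM (h ▸ hi), mem_univ i⟩ : M ⊆ univ.erase e) hle hcard
    have heM' : e ∉ M' := fun h => (mem_erase.1 (hM'e h)).1 rfl
    refine ⟨M', heM', hM', ?_⟩
    exact value_le_of_isOptimalSize hq hqr hr heM' (hM'.symm ▸ hm) hφ.nonneg hφ.le_one
      (hφ.dependsOnlyOn.mono (insert_subset_insert _ hMM'))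
  · obtain ⟨k, hk⟩ := Nat.exists_eq_add_of_le hle
    induction k generalizing M φ with
    | zero =>
      exact ⟨M, heM, hk, value_le_of_isOptimalSize hq hqr hr heM (by rw [hk]; exact hm)
        hφ.nonneg hφ.le_one hφ.dependsOnlyOn⟩
    | succ k ih =>
      obtain ⟨j, hj⟩ : M.Nonempty := card_pos.1 (by omega)
      have hcard : (M.erase j).card = m + k := by rw [card_erase_of_mem hj]; omega
      have heM1 : e ∉ M.erase j := fun h => heM (mem_of_mem_erase h)
      obtain ⟨M', h1, h2, h3⟩ := ih heM1 (delegationRule_isAdmissible e (M.erase j))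
        (by omega) hcard
      refine ⟨M', h1, h2, le_trans (le_trans (b := value (singleExpertCommittee e q r) e
        (delegationRule e M)) ?_ ?_) h3⟩
      · exact value_le_delegationRule hq hqr hr heM Subset.rfl hφ.le_one hφ.dependsOnlyOn
          hφ.majority fun s hs => by
            have h4 : (2 * opposed e M s : ℝ) ≤ Fintype.card V := by exact_mod_cast hs
            have h5 := hm.le_weight
            have h6 : (m : ℝ) ≤ M.card := by exact_mod_cast hle
            linarith
      · have h4 := value_delegationRule_insert_le hN hq hqr hr (notMem_erase j M)
          (by rwa [insert_erase hj]) (by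
            rw [hcard]
            have h5 := hm.le_weight
            push_cast
            have : (0 : ℝ) ≤ k := by positivity
            linarith)
        rwa [insert_erase hj] at h4

/-- There is a best set of `m` voters voting on their own, and the delegation rule with that set
beats all admissible rules. -/
theorem exists_best_delegationRule (e : V) (hN : Odd (Fintype.card V)) {q r : ℝ}
    (hq : 1 / 2 < q) (hqr : q < r) (hr : r < 1) {m : ℕ}
    (hm : IsOptimalSize (Fintype.card V) (expertWeight q r) m) :
    ∃ M : Finset V, e ∉ M ∧ M.card = m ∧ ∀ (M' : Finset V) (φ : (V → Side) → ℝ), e ∉ M' →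
      IsAdmissible e M' φ → value (singleExpertCommittee e q r) e φ ≤
        value (singleExpertCommittee e q r) e (delegationRule e M) := by
  -- This only supplies some set of size `m`. Maximizing over such sets makes a symmetry argument
  -- unnecessary.
  obtain ⟨M₀, hM₀, hcard₀, -⟩ := exists_optimalSize_value_le hN hq hqr hr hm
    (notMem_empty e) (delegationRule_isAdmissible e ∅)
  obtain ⟨M, hM, hmax⟩ := exists_max_image (univ.filter fun M : Finset V => e ∉ M ∧ M.card = m)
    (fun M => value (singleExpertCommittee e q r) e (delegationRule e M))
    ⟨M₀, by simp [hM₀, hcard₀]⟩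
  obtain ⟨h1, h2⟩ := (mem_filter.1 hM).2
  refine ⟨M, h1, h2, fun M' φ heM' hφ => ?_⟩
  obtain ⟨M₁, h3, h4, h5⟩ := exists_optimalSize_value_le hN hq hqr hr hm heM' hφ
  exact h5.trans (hmax M₁ (by simp [h3, h4]))

/-! ### Strict gains from giving the expert more weight -/

theorem weightRule_lt {e : V} {q r : ℝ} (hq : 1 / 2 < q) (hqr : q < r) (hr : r < 1)
    {T M M' : Finset V} (heT : e ∉ T) (hM : M ⊆ T) (hM' : M' ⊆ T) {k k' : ℕ}
    (h : ∀ s, weightRule e k M s = weightRule e k' M' s ∨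
      weightRule e k M s < weightRule e k' M' s ∧
        2 * (opposed e T s : ℝ) < expertWeight q r + T.card)
    (h₀ : ∃ s, weightRule e k M s ≠ weightRule e k' M' s) :
    value (singleExpertCommittee e q r) e (weightRule e k M) <
      value (singleExpertCommittee e q r) e (weightRule e k' M') := by
  have hdep : ∀ (k : ℕ) (M : Finset V), M ⊆ T → DependsOnlyOn (insert e T) (weightRule e k M) := by
    intro k M hM s t hst
    unfold weightRule
    rw [opposed_congr (hst e (mem_insert_self _ _)) fun i hi => hst i (mem_insert_of_mem (hM hi))]
  obtain ⟨s₀, hs₀⟩ := h₀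
  have hlt : ∀ s, weightRule e k M s < weightRule e k' M' s ∧
        2 * (opposed e T s : ℝ) < expertWeight q r + T.card →
      weightRule e k M s * advantage ((singleExpertCommittee e q r).restrict (insert e T)) e s <
      weightRule e k' M' s *
        advantage ((singleExpertCommittee e q r).restrict (insert e T)) e s :=
    fun s hs => mul_lt_mul_of_pos_right hs.1 ((expert_advantage_iff hq hqr hr heT s).1.2 hs.2)
  refine value_lt_value (mem_insert_self e T) (hdep k M hM) (hdep k' M' hM') (fun s => ?_) s₀
    (hlt s₀ ((h s₀).resolve_left hs₀))
  rcases h s with h | h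
  · rw [h]
  · exact (hlt s h).le

/-- The rules differ only if the opposition is half of `M` or half a vote more; an expert weight
above one settles both cases in her favor. -/
theorem weightRule_zero_lt_one {e : V} {q r : ℝ} (hq : 1 / 2 < q) (hqr : q < r) (hr : r < 1)
    {M : Finset V} (heM : e ∉ M) :
    value (singleExpertCommittee e q r) e (weightRule e 0 M) <
      value (singleExpertCommittee e q r) e (weightRule e 1 M) := by
  have hW := one_lt_expertWeight hq hqr hr
  refine weightRule_lt hq hqr hr heM Subset.rfl Subset.rfl (fun s => ?_) ?_
  · by_cases h : 2 * opposed e M s = M.card ∨ 2 * opposed e M s = M.card + 1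
    · refine Or.inr ⟨?_, ?_⟩
      · unfold weightRule
        split_ifs <;> first | omega | norm_num
      · have : (2 * opposed e M s : ℝ) ≤ M.card + 1 := by
          have : 2 * opposed e M s ≤ M.card + 1 := by omega
          exact_mod_cast this
        linarith
    · left
      unfold weightRule
      split_ifs <;> first | omega | rfl
  · obtain ⟨s, hs⟩ := exists_opposed_eq heM (n := (M.card + 1) / 2) (by omega)
    refine ⟨s, ?_⟩
    unfold weightRule
    split_ifs <;> first | omega | norm_num

/-- With an even number of votes, the second vote of `e` only breaks ties, and in a tie her signal
outweighs one nonexpert's. -/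
theorem weightRule_one_lt_two_of_odd {e : V} {q r : ℝ} (hq : 1 / 2 < q) (hqr : q < r)
    (hr : r < 1) {M : Finset V} (heM : e ∉ M) (hM : Odd M.card) :
    value (singleExpertCommittee e q r) e (weightRule e 1 M) <
      value (singleExpertCommittee e q r) e (weightRule e 2 M) := by
  have hW := one_lt_expertWeight hq hqr hr
  obtain ⟨k, hk⟩ := hM
  refine weightRule_lt hq hqr hr heM Subset.rfl Subset.rfl (fun s => ?_) ?_
  · by_cases h : 2 * opposed e M s = M.card + 1
    · refine Or.inr ⟨?_, ?_⟩
      · unfold weightRule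
        split_ifs <;> first | omega | norm_num
      · have : (2 * opposed e M s : ℝ) = M.card + 1 := by exact_mod_cast h
        linarith
    · left
      unfold weightRule
      split_ifs <;> first | omega | rfl
  · obtain ⟨s, hs⟩ := exists_opposed_eq heM (n := k + 1) (by omega)
    refine ⟨s, ?_⟩
    unfold weightRule
    split_ifs <;> first | omega | norm_num

/-- Handing the vote of `j` to `e` matters only when `j` is pivotal against her. There she is
opposed by a net two voters, fewer than her optimal weight. -/
theorem weightRule_one_insert_lt_two {e : V} {q r : ℝ} (hq : 1 / 2 < q) (hqr : q < r)
    (hr : r < 1) (hW : 2 < expertWeight q r) {M : Finset V} {j : V} (hj : j ∉ M)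
    (heM : e ∉ insert j M) (hM : Odd M.card) :
    value (singleExpertCommittee e q r) e (weightRule e 1 (insert j M)) <
      value (singleExpertCommittee e q r) e (weightRule e 2 M) := by
  obtain ⟨k, hk⟩ := hM
  have hcard := card_insert_of_notMem hj
  have hej : j ≠ e := fun h => heM (h ▸ mem_insert_self _ _)
  refine weightRule_lt hq hqr hr heM Subset.rfl (subset_insert j M) (fun s => ?_) ?_
  · have hop := opposed_insert (e := e) hj s
    by_cases h : 2 * opposed e (insert j M) s = M.card + 3 ∧ s j ≠ s e
    · rw [if_pos h.2] at hop
      refine Or.inr ⟨?_, ?_⟩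
      · unfold weightRule
        split_ifs <;> first | omega | norm_num
      · have : (2 * opposed e (insert j M) s : ℝ) = M.card + 3 := by exact_mod_cast h.1
        rw [hcard]
        push_cast
        linarith
    · left
      unfold weightRule
      split_ifs at hop ⊢ <;>
        first | omega | rfl | exact absurd ⟨by omega, ‹s j ≠ s e›⟩ h
  · have heM' : e ∉ M := fun h => heM (mem_insert_of_mem h)
    obtain ⟨s, hs⟩ := exists_opposed_eq heM' (n := k + 1) (by omega)
    have hs' : opposed e M (Function.update s j (!s e)) = k + 1 := by
      rw [← hs]
      refine opposed_congr (by simp [hej.symm]) fun i hi => ?_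
      rw [Function.update_of_ne (ne_of_mem_of_not_mem hi hj)]
    have hop := opposed_insert (e := e) hj (Function.update s j (!s e))
    rw [if_pos (by simp [hej.symm])] at hop
    refine ⟨Function.update s j (!s e), ?_⟩
    unfold weightRule
    split_ifs <;> first | omega | norm_num

/-- If all of `M` opposes `e`, it is a strict majority of the committee and overrules her, with a
strictly negative advantage. -/
theorem weightRule_empty_lt {e : V} {q r : ℝ} (hq : 1 / 2 < q) (hqr : q < r)
    (hr : r < 1) {M : Finset V} (heM : e ∉ M)
    (hM : IsOptimalSize (Fintype.card V) (expertWeight q r) M.card)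
    (hcard : Fintype.card V < 2 * M.card) :
    value (singleExpertCommittee e q r) e (weightRule e 1 ∅) <
      value (singleExpertCommittee e q r) e (delegationRule e M) := by
  have h1 : ∀ s, weightRule e 1 ∅ s = 1 := by intro s; simp [weightRule, opposed]
  obtain ⟨s₀, hs₀⟩ := exists_opposed_eq heM le_rfl
  refine value_lt_value (mem_insert_self e M) (fun s t _ => by rw [h1, h1])
    (delegationRule_isAdmissible e M).dependsOnlyOn
    (fun s => mul_advantage_le_delegationRule hq hqr hr heM hM (by simp [h1]) (by simp [h1]) s)
    s₀ ?_
  rcases delegationRule_optimal hq hqr hr heM hM s₀ with ⟨-, h2, h3⟩ | ⟨h2, -⟩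
  · rw [h1, h2]; linarith
  · rw [delegationRule, if_pos (by omega)] at h2
    norm_num at h2

theorem weightRule_le_one_lt_delegationRule {e : V} (hN : Odd (Fintype.card V)) {q r : ℝ}
    (hq : 1 / 2 < q) (hqr : q < r) (hr : r < 1) (hW : 2 < expertWeight q r) {M : Finset V}
    (heM : e ∉ M) (hM : IsOptimalSize (Fintype.card V) (expertWeight q r) M.card)
    (hcard : Fintype.card V < 2 * M.card)
    (hbest : ∀ (M' : Finset V) (φ : (V → Side) → ℝ), e ∉ M' → IsAdmissible e M' φ →
      value (singleExpertCommittee e q r) e φ ≤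
        value (singleExpertCommittee e q r) e (delegationRule e M))
    {M' : Finset V} (heM' : e ∉ M') {k : ℕ} (hk : k ≤ 1) :
    value (singleExpertCommittee e q r) e (weightRule e k M') <
      value (singleExpertCommittee e q r) e (delegationRule e M) := by
  have hlt : M'.card < Fintype.card V := by
    rw [← card_univ]
    exact card_lt_card (ssubset_univ_iff.2 fun h => heM' (h ▸ mem_univ e))
  rcases Nat.le_one_iff_eq_zero_or_eq_one.1 hk with rfl | rfl
  · exact (weightRule_zero_lt_one hq hqr hr heM').trans_le
      (hbest M' _ heM' (weightRule_isAdmissible e (by omega)))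
  -- Weight two must remain admissible, so that total weight may not exceed N. Even `M'` gives up
  -- one voter; odd `M'` has room, since N is odd.
  · rcases Nat.even_or_odd M'.card with heven | hodd
    · rcases M'.eq_empty_or_nonempty with rfl | ⟨j, hj⟩
      · exact weightRule_empty_lt hq hqr hr heM hM hcard
      · have hpos : 0 < M'.card := card_pos.2 ⟨j, hj⟩
        have hc : (M'.erase j).card = M'.card - 1 := card_erase_of_mem hj
        have heM1 : e ∉ M'.erase j := fun h => heM' (mem_of_mem_erase h)
        have h1 := weightRule_one_insert_lt_two hq hqr hr hW (notMem_erase j M')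
          (by rwa [insert_erase hj]) (by rw [hc]; exact Nat.Even.sub_odd hpos heven odd_one)
        rw [insert_erase hj] at h1
        exact h1.trans_le (hbest _ _ heM1 (weightRule_isAdmissible e (by omega)))
    · have hne : M'.card + 1 ≠ Fintype.card V := by
        intro h
        rw [← h] at hN
        exact (Nat.not_odd_iff_even.2 hodd.add_one) hN
      exact (weightRule_one_lt_two_of_odd hq hqr hr heM' hodd).trans_le
        (hbest _ _ heM' (weightRule_isAdmissible e (by omega)))

end Rules

/-! ### Election outcomes, common payoffs and undominated strategies -/

section Voting

variable {V : Type*} [Fintype V] [DecidableEq V]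

omit [DecidableEq V] in
theorem castVote_of_not_delegate {act : V → Action V} {i : V}
    (h : ∀ j, act i ≠ Action.delegate j) : castVote act i = act i := by
  have hf : follow act i = i := by
    unfold follow
    split
    · exact absurd ‹_› (h _)
    · rfl
  rw [castVote, Function.iterate_fixed hf]

omit [DecidableEq V] in
theorem castVote_of_delegate {act : V → Action V} {i j : V} (hi : act i = Action.delegate j)
    (hj : ∀ k, act j ≠ Action.delegate k) : castVote act i = act j := by
  have hf : follow act i = j := by simp [follow, hi]
  have hj' := castVote_of_not_delegate hj
  -- The committee is nonempty, so at least one step is taken; it reaches `j`, a fixed point of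
  -- `follow`.
  obtain ⟨n, hn⟩ := Nat.exists_eq_succ_of_ne_zero (Fintype.card_pos_iff.2 ⟨i⟩).ne'
  have hfj : follow act j = j := by
    unfold follow
    split
    · exact absurd ‹_› (hj _)
    · rfl
  rw [castVote, hn, Function.iterate_succ_apply, hf, Function.iterate_fixed hfj]

theorem card_le_votesFor {act : V → Action V} {X : Side} {S : Finset V}
    (h : ∀ i ∈ S, castVote act i = Action.vote X) : S.card ≤ votesFor act X :=
  card_le_card fun i hi => by simp [h i hi]

theorem votesFor_le_card {act : V → Action V} {X : Side} {S : Finset V}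
    (h : ∀ i ∉ S, castVote act i ≠ Action.vote X) : votesFor act X ≤ S.card :=
  card_le_card fun i hi => by
    by_contra hS
    exact h i hS (by simpa using hi)

theorem votesFor_eq_zero {act : V → Action V} {X : Side} (h : ∀ i, act i ≠ Action.vote X) :
    votesFor act X = 0 := by
  have := votesFor_le_card (act := act) (X := X) (S := ∅) fun i _ => h _
  simpa using this

theorem votesFor_add_le (act : V → Action V) (X : Side) :
    votesFor act X + votesFor act (!X) ≤ Fintype.card V := by
  unfold votesFor
  rw [← card_union_of_disjoint, ← card_univ]
  · exact card_le_card (subset_univ _)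
  · refine disjoint_filter.2 fun i _ h1 h2 => ?_
    rw [h1] at h2
    cases X <;> simp at h2

theorem winProb_nonneg (act : V → Action V) (X : Side) : 0 ≤ winProb act X := by
  unfold winProb; split_ifs <;> norm_num

theorem winProb_le_one (act : V → Action V) (X : Side) : winProb act X ≤ 1 := by
  unfold winProb; split_ifs <;> norm_num

theorem winProb_not (act : V → Action V) (X : Side) : winProb act (!X) = 1 - winProb act X := by
  unfold winProb
  rw [Bool.not_not]
  split_ifs <;> first | omega | norm_num

theorem winProb_eq_one {act : V → Action V} {X : Side}
    (h : votesFor act (!X) < votesFor act X) : winProb act X = 1 := by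
  rw [winProb, if_pos h]

theorem winProb_lt_one {act : V → Action V} {X : Side}
    (h : votesFor act X ≤ votesFor act (!X)) : winProb act X < 1 := by
  unfold winProb
  split_ifs <;> first | omega | norm_num

theorem winProb_eq_one_of_majority {act : V → Action V} {X : Side} {S : Finset V}
    (h : ∀ i ∈ S, castVote act i = Action.vote X) (hS : Fintype.card V < 2 * S.card) :
    winProb act X = 1 := by
  have h1 := card_le_votesFor h
  have h2 := votesFor_add_le act X
  exact winProb_eq_one (by omega)

/-- The probability that the alternative indicated by the signal of `c` is elected. -/
noncomputable def followProb (σ : Profile V) (c : V) (s : V → Side) : ℝ := winProb (actions σ s) (s c)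

theorem followProb_dependsOnlyOn {σ : Profile V} {c : V} {T : Finset V} (hc : c ∈ T)
    (h : ∀ j ∉ T, σ j true = σ j false) : DependsOnlyOn T (followProb σ c) := by
  intro s t hst
  have hact : actions σ s = actions σ t := by
    funext j
    unfold actions
    by_cases hj : j ∈ T
    · rw [hst j hj]
    · have := h j hj
      cases s j <;> cases t j <;> simp [this]
  rw [followProb, followProb, hact, hst c hc]

/-- The first term is the accuracy of always electing the alternative against the signal of `c`;
following `c` changes it by the advantage. -/
theorem correctProb_eq (C : Committee V) (hC : C.prior = 1 / 2) (c : V) (σ : Profile V) :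
    correctProb C σ = 1 / 2 * ∑ s, signalProb C (!s c) s + 1 / 2 * value C c (followProb σ c) := by
  have h1 : ∀ ω, stateProb C ω = 1 / 2 := by
    intro ω
    unfold stateProb
    rw [hC]
    split_ifs <;> norm_num
  rw [correctProb, Fintype.sum_bool, h1, h1, ← mul_add, ← sum_add_distrib, value, ← mul_add,
    ← sum_add_distrib]
  congr 1
  refine sum_congr rfl fun s _ => ?_
  unfold followProb advantage
  have h2 := winProb_not (actions σ s) true
  rw [Bool.not_true] at h2
  cases s c <;> simp only [Bool.not_true, Bool.not_false, h2] <;> ring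

theorem expectedUtility_eq_correctProb (e : V) (q r : ℝ) (σ : Profile V) (i : V) :
    expectedUtility (singleExpertCommittee e q r) σ i =
      correctProb (singleExpertCommittee e q r) σ := by
  unfold expectedUtility correctProb
  refine sum_congr rfl fun ω _ => ?_
  congr 1
  refine sum_congr rfl fun s _ => ?_
  congr 1
  simp [singleExpertCommittee, payoff]

theorem correctProb_le_iff (e : V) (q r : ℝ) (c : V) (σ τ : Profile V) :
    correctProb (singleExpertCommittee e q r) σ ≤ correctProb (singleExpertCommittee e q r) τ ↔
      value (singleExpertCommittee e q r) c (followProb σ c) ≤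
        value (singleExpertCommittee e q r) c (followProb τ c) := by
  rw [correctProb_eq _ rfl c, correctProb_eq _ rfl c]
  constructor <;> intro h <;> linarith

theorem correctProb_lt_iff (e : V) (q r : ℝ) (c : V) (σ τ : Profile V) :
    correctProb (singleExpertCommittee e q r) σ < correctProb (singleExpertCommittee e q r) τ ↔
      value (singleExpertCommittee e q r) c (followProb σ c) <
        value (singleExpertCommittee e q r) c (followProb τ c) := by
  rw [← not_le, ← not_le, correctProb_le_iff]

/-- A dominating strategy must differ from `τ` somewhere, so one losing profile for each different
strategy suffices. -/
theorem not_isWeaklyDominated {M : Mechanism V} {e : V} {q r : ℝ} {i : V} {τ : Strategy V}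
    (h : ∀ τ', IsFeasible M i τ' → (∃ x, τ' x ≠ τ x) → ∃ σ, IsFeasibleProfile M σ ∧
      correctProb (singleExpertCommittee e q r) (Function.update σ i τ') <
        correctProb (singleExpertCommittee e q r) (Function.update σ i τ)) :
    ¬ IsWeaklyDominated M (singleExpertCommittee e q r) i τ := by
  rintro ⟨τ', hτ', h1, σ, -, h2⟩
  simp only [expectedUtility_eq_correctProb] at h1 h2
  by_cases hne : ∃ x, τ' x ≠ τ x
  · obtain ⟨σ', hσ', h3⟩ := h τ' hτ' hne
    exact absurd (h1 σ' hσ') (not_le.2 h3)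
  · push Not at hne
    rw [funext hne] at h2
    exact lt_irrefl _ h2

/-- If the signals in `T` never overturn that of `c`, always following `c` is the best use of them.
-/
theorem correctProb_le_of_followProb_eq_one {e : V} {q r : ℝ} {c : V} {T : Finset V}
    (hc : c ∈ T) (hadv : ∀ s, 0 < advantage ((singleExpertCommittee e q r).restrict T) c s)
    {σ τ : Profile V} (hσ : ∀ j ∉ T, σ j true = σ j false) (hτ : ∀ s, followProb τ c s = 1) :
    correctProb (singleExpertCommittee e q r) σ ≤ correctProb (singleExpertCommittee e q r) τ := by
  rw [correctProb_le_iff e q r c]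
  refine value_le_value hc (followProb_dependsOnlyOn hc hσ)
    (fun s t _ => by rw [hτ, hτ]) fun s => ?_
  rw [hτ s]
  exact mul_le_mul_of_nonneg_right (winProb_le_one _ _) (hadv s).le

theorem correctProb_lt_of_followProb_eq_one {e : V} {q r : ℝ} {c : V} {T : Finset V}
    (hc : c ∈ T) (hadv : ∀ s, 0 < advantage ((singleExpertCommittee e q r).restrict T) c s)
    {σ τ : Profile V} (hσ : ∀ j ∉ T, σ j true = σ j false) (hτ : ∀ s, followProb τ c s = 1)
    {s₀ : V → Side} (hs₀ : followProb σ c s₀ < 1) :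
    correctProb (singleExpertCommittee e q r) σ < correctProb (singleExpertCommittee e q r) τ := by
  rw [correctProb_lt_iff e q r c]
  refine value_lt_value hc (followProb_dependsOnlyOn hc hσ)
    (fun s t _ => by rw [hτ, hτ]) (fun s => ?_) s₀ ?_
  · rw [hτ s]
    exact mul_le_mul_of_nonneg_right (winProb_le_one _ _) (hadv s).le
  · rw [hτ s₀]
    exact mul_lt_mul_of_pos_right hs₀ (hadv s₀)

theorem advantage_singleton_pos {e : V} {q r : ℝ} (hq : 1 / 2 < q) (hqr : q < r) (hr : r < 1)
    (i : V) (s : V → Side) :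
    0 < advantage ((singleExpertCommittee e q r).restrict {i}) i s := by
  have hp : 1 / 2 < (singleExpertCommittee e q r).precision i ∧
      (singleExpertCommittee e q r).precision i < 1 := by
    simp only [singleExpertCommittee]
    split_ifs <;> constructor <;> linarith
  have hpos : ∀ x : ℝ, 1 / 2 < x → x < 1 → 0 < Real.log (x / (1 - x)) := fun x h1 h2 =>
    Real.log_pos (by rw [lt_div_iff₀ (by linarith)]; linarith)
  have h := (advantage_restrict_iff (singleExpertCommittee e q r) i ∅ (notMem_empty i) q
    (by simp) hq (hqr.trans hr) (by linarith [hp.1]) hp.2 s).1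
  rw [insert_empty] at h
  rw [h]
  have : 0 < expertWeight q ((singleExpertCommittee e q r).precision i) :=
    div_pos (hpos _ hp.1 hp.2) (hpos _ hq (hqr.trans hr))
  simpa [opposed] using this

theorem advantage_pair_pos {e : V} {q r : ℝ} (hq : 1 / 2 < q) (hqr : q < r) (hr : r < 1)
    {i : V} (hi : i ≠ e) (s : V → Side) :
    0 < advantage ((singleExpertCommittee e q r).restrict {e, i}) e s := by
  rw [(expert_advantage_iff hq hqr hr (by simpa using hi.symm) s).1]
  have h1 := one_lt_expertWeight hq hqr hr
  have h2 : (opposed e {i} s : ℝ) ≤ 1 := by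
    exact_mod_cast (opposed_le_card e {i} s).trans (card_singleton i).le
  rw [card_singleton]
  push_cast
  linarith

/-- Against universal abstention the voter decides alone, and only sincerity always elects what her
signal indicates. -/
theorem sincere_not_isWeaklyDominated {M : Mechanism V} {e : V} {q r : ℝ} (hq : 1 / 2 < q)
    (hqr : q < r) (hr : r < 1) (hM : ∀ i, Action.abstain ∈ M i) {i : V} {τ : Strategy V}
    (hτ : IsSincere τ) : ¬ IsWeaklyDominated M (singleExpertCommittee e q r) i τ := by
  refine not_isWeaklyDominated fun τ' _ ⟨x, hx⟩ =>
    ⟨fun _ _ => Action.abstain, fun j _ => hM j, ?_⟩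
  have hconst : ∀ j ∉ ({i} : Finset V), Function.update (fun _ _ => Action.abstain) i τ' j true =
      Function.update (fun _ _ => (Action.abstain : Action V)) i τ' j false := by
    intro j hj
    rw [Function.update_of_ne (by simpa using hj)]
  refine correctProb_lt_of_followProb_eq_one (mem_singleton_self i)
    (advantage_singleton_pos hq hqr hr i) hconst (fun s => ?_) (s₀ := fun _ => x) ?_
  · refine winProb_eq_one ?_
    have h1 : votesFor (actions (Function.update (fun _ _ => Action.abstain) i τ) s) (!s i) = 0 := by
      refine votesFor_eq_zero fun j => ?_
      by_cases hj : j = i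
      · subst hj
        simp [actions, hτ (s j)]
      · simp [actions, hj]
    have h2 : 1 ≤ votesFor (actions (Function.update (fun _ _ => Action.abstain) i τ) s) (s i) := by
      rw [← card_singleton i]
      refine card_le_votesFor fun j hj => ?_
      rw [mem_singleton.1 hj, castVote_of_not_delegate] <;> simp [actions, hτ (s i)]
    omega
  · refine winProb_lt_one ?_
    rw [votesFor_eq_zero]
    · exact Nat.zero_le _
    · intro j
      by_cases hj : j = i
      · subst hj
        simpa [actions, hτ x] using hx
      · simp [actions, hj]

/-! ### The delegation profile in liquid democracy -/

/-- The profile in which `e` and the voters in `M` vote sincerely and all others delegate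
to `e`. -/
def delegationProfile (e : V) (M : Finset V) : Profile V := fun i s =>
  if i ∈ insert e M then Action.vote s else Action.delegate e

omit [Fintype V] in
theorem delegationProfile_isSincere {e : V} {M : Finset V} {i : V} (hi : i ∈ insert e M) :
    IsSincere (delegationProfile e M i) := fun s => by rw [delegationProfile, if_pos hi]

omit [Fintype V] in
theorem delegationProfile_delegatesTo {e : V} {M : Finset V} {i : V} (hi : i ∉ insert e M) :
    DelegatesTo (delegationProfile e M i) e := fun s => by rw [delegationProfile, if_neg hi]

omit [Fintype V] in
theorem delegationProfile_isNeutral (e : V) (M : Finset V) (i : V) :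
    IsNeutral (delegationProfile e M i) := by
  by_cases hi : i ∈ insert e M
  · exact Or.inl (delegationProfile_isSincere hi)
  · exact Or.inr (Or.inr ⟨e, delegationProfile_delegatesTo hi⟩)

omit [Fintype V] in
theorem delegationProfile_isFeasible (e : V) (M : Finset V) :
    IsFeasibleProfile liquidDemocracy (delegationProfile e M) := by
  intro i s
  by_cases hi : i ∈ insert e M
  · simp [liquidDemocracy, delegationProfile_isSincere hi s]
  · have : e ≠ i := fun h => hi (h ▸ mem_insert_self e M)
    simpa [liquidDemocracy, delegationProfile_delegatesTo hi s] using this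

theorem followProb_delegationProfile (hN : Odd (Fintype.card V)) {e : V} {M : Finset V}
    (heM : e ∉ M) (s : V → Side) :
    followProb (delegationProfile e M) e s = delegationRule e M s := by
  have hsin : ∀ i ∈ insert e M, castVote (actions (delegationProfile e M) s) i =
      Action.vote (s i) := by
    intro i hi
    rw [castVote_of_not_delegate] <;> simp [actions, delegationProfile_isSincere hi (s i)]
  unfold delegationRule
  split_ifs with h
  · have h1 := winProb_not (actions (delegationProfile e M) s) (s e)
    rw [winProb_eq_one_of_majority (S := M.filter fun i => s i ≠ s e) (fun i hi => ?_) h] at h1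
    · rw [followProb]; linarith
    · obtain ⟨hi, hne⟩ := mem_filter.1 hi
      rw [hsin i (mem_insert_of_mem hi)]
      congr 1
      cases h1 : s i <;> cases h2 : s e <;> simp_all
  · refine winProb_eq_one_of_majority (S := (M.filter fun i => s i ≠ s e)ᶜ) (fun i hi => ?_) ?_
    · by_cases hiM : i ∈ insert e M
      · rw [hsin i hiM]
        rcases mem_insert.1 hiM with rfl | hiM
        · rfl
        · simp only [mem_compl, mem_filter, not_and, not_not] at hi
          rw [hi hiM]
      · have he := delegationProfile_isSincere (mem_insert_self e M) (s e)
        rw [castVote_of_delegate (delegationProfile_delegatesTo hiM (s i))]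
        · exact he
        · intro k
          simp [actions, he]
    -- Oddness excludes a tie, so those not opposed to `e` form a strict majority.
    · rw [card_compl]
      change ¬ Fintype.card V < 2 * (M.filter fun i => s i ≠ s e).card at h
      obtain ⟨k, hk⟩ := hN
      omega

theorem followProb_eq_zero_of_majority {σ : Profile V} {e : V} {M : Finset V}
    (hσ : ∀ i ∈ M, IsSincere (σ i)) {s : V → Side} (h : Fintype.card V < 2 * opposed e M s) :
    followProb σ e s = 0 := by
  have h1 := winProb_not (actions σ s) (s e)
  rw [winProb_eq_one_of_majority (S := M.filter fun i => s i ≠ s e) (fun i hi => ?_) h] at h1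
  · rw [followProb]; linarith
  · obtain ⟨hi, hne⟩ := mem_filter.1 hi
    have hi' := hσ i hi (s i)
    rw [castVote_of_not_delegate (by simp [actions, hi']), actions, hi']
    congr 1
    cases h1 : s i <;> cases h2 : s e <;> simp_all

omit [Fintype V] [DecidableEq V] in
theorem IsNeutral.const_of_not_isSincere {τ : Strategy V} (h : IsNeutral τ)
    (hτ : ¬ IsSincere τ) : τ true = τ false := by
  rcases h with h | h | ⟨j, h⟩
  · exact absurd h hτ
  · rw [h, h]
  · rw [h, h]

open Classical in
/-- The voters other than `e` who vote sincerely. -/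
noncomputable def sincereNonexperts (σ : Profile V) (e : V) : Finset V :=
  univ.filter fun i => i ≠ e ∧ IsSincere (σ i)

theorem isSincere_of_mem_sincereNonexperts {σ : Profile V} {e i : V}
    (hi : i ∈ sincereNonexperts σ e) : IsSincere (σ i) := by
  simp only [sincereNonexperts, mem_filter] at hi
  exact hi.2.2

theorem notMem_sincereNonexperts (σ : Profile V) (e : V) : e ∉ sincereNonexperts σ e := by
  simp [sincereNonexperts]

/-- A neutral strategy that is not sincere ignores its signal, and no behavior of the others
overturns a strict majority of the committee voting directly. -/
theorem followProb_isAdmissible {σ : Profile V} (hσ : ∀ i, IsNeutral (σ i)) (e : V) :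
    IsAdmissible e (sincereNonexperts σ e) (followProb σ e) where
  nonneg s := winProb_nonneg _ _
  le_one s := winProb_le_one _ _
  dependsOnlyOn := followProb_dependsOnlyOn (mem_insert_self _ _) fun j hj =>
    (hσ j).const_of_not_isSincere fun h => hj (by
      by_cases hje : j = e
      · exact hje ▸ mem_insert_self _ _
      · exact mem_insert_of_mem (by simp [sincereNonexperts, hje, h]))
  majority s h := followProb_eq_zero_of_majority
    (fun _ hi => isSincere_of_mem_sincereNonexperts hi) h

/-- Let `e` vote sincerely, `k` vote for a fixed `X`, and the rest abstain. Delegation always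
carries `e` past `k`; any different strategy sometimes leaves her without the second vote. -/
theorem delegatesTo_not_isWeaklyDominated {e : V} {q r : ℝ} (hq : 1 / 2 < q) (hqr : q < r)
    (hr : r < 1) {i k : V} (hie : i ≠ e) (hki : k ≠ i) (hke : k ≠ e) {τ : Strategy V}
    (hτ : DelegatesTo τ e) :
    ¬ IsWeaklyDominated liquidDemocracy (singleExpertCommittee e q r) i τ := by
  refine not_isWeaklyDominated fun τ' hfeas ⟨x, hx⟩ => ?_
  -- `X` is chosen so that `τ'` at the signal `x` does not happen to vote with `e` when she opposes
  -- `k`.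
  obtain ⟨X, hX⟩ : ∃ X : Side, τ' x ≠ Action.vote (!X) := by
    by_cases h : τ' x = Action.vote true
    · exact ⟨true, by simp [h]⟩
    · exact ⟨false, h⟩
  let σ : Profile V := fun j s => if j = e then Action.vote s
    else if j = k then Action.vote X else Action.abstain
  have hσe : ∀ (ρ : Strategy V) (s : V → Side),
      actions (Function.update σ i ρ) s e = Action.vote (s e) := by
    intro ρ s; simp [actions, σ, hie.symm]
  have hσk : ∀ (ρ : Strategy V) (s : V → Side),
      actions (Function.update σ i ρ) s k = Action.vote X := by
    intro ρ s; simp [actions, σ, hki, hke]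
  have hσi : ∀ (ρ : Strategy V) (s : V → Side),
      actions (Function.update σ i ρ) s i = ρ (s i) := by
    intro ρ s; simp [actions]
  have hσj : ∀ (ρ : Strategy V) (s : V → Side) (j : V), j ≠ e → j ≠ k → j ≠ i →
      actions (Function.update σ i ρ) s j = Action.abstain := by
    intro ρ s j h1 h2 h3; simp [actions, σ, h1, h2, h3]
  have hnd : ∀ (ρ : Strategy V) (s : V → Side) (j : V), j ≠ i →
      ∀ l, actions (Function.update σ i ρ) s j ≠ Action.delegate l := by
    intro ρ s j hj l
    by_cases h1 : j = e
    · subst h1; simp [hσe]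
    · by_cases h2 : j = k
      · subst h2; simp [hσk]
      · simp [hσj ρ s j h1 h2 hj]
  refine ⟨σ, fun j s => ?_, ?_⟩
  · simp only [σ, liquidDemocracy, Set.mem_ofPred_eq]
    split_ifs <;> simp
  have hconst : ∀ j ∉ ({e, i} : Finset V),
      Function.update σ i τ' j true = Function.update σ i τ' j false := by
    intro j hj
    simp only [mem_insert, mem_singleton, not_or] at hj
    simp [σ, hj.1, hj.2]
  refine correctProb_lt_of_followProb_eq_one (mem_insert_self e {i})
    (advantage_pair_pos hq hqr hr hie) hconst (fun s => ?_)
    (s₀ := fun j => if j = e then !X else x) ?_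
  · refine winProb_eq_one ?_
    have h1 : 2 ≤ votesFor (actions (Function.update σ i τ) s) (s e) := by
      rw [← card_pair hie]
      refine card_le_votesFor fun j hj => ?_
      rcases mem_insert.1 hj with rfl | hj
      · rw [castVote_of_delegate ((hσi τ s).trans (hτ _)) (hnd τ s e hie.symm), hσe]
      · rw [mem_singleton.1 hj, castVote_of_not_delegate (hnd τ s e hie.symm), hσe]
    have h2 : votesFor (actions (Function.update σ i τ) s) (!s e) ≤ 1 := by
      rw [← card_singleton k]
      refine votesFor_le_card fun j hj => ?_
      by_cases hji : j = i
      · subst hji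
        rw [castVote_of_delegate ((hσi τ s).trans (hτ _)) (hnd τ s e hie.symm), hσe]
        simp
      · rw [castVote_of_not_delegate (hnd τ s j hji)]
        by_cases hje : j = e
        · subst hje; simp [hσe]
        · simp [hσj τ s j hje (by simpa using hj) hji]
    omega
  · refine winProb_lt_one ?_
    simp only [if_true]
    set s : V → Side := fun j => if j = e then !X else x
    have hsi : s i = x := if_neg hie
    have h1 : 1 ≤ votesFor (actions (Function.update σ i τ') s) (!!X) := by
      rw [← card_singleton k, Bool.not_not]
      refine card_le_votesFor fun j hj => ?_
      rw [mem_singleton.1 hj, castVote_of_not_delegate (hnd τ' s k hki), hσk]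
    have h2 : votesFor (actions (Function.update σ i τ') s) (!X) ≤ 1 := by
      rw [← card_singleton e]
      have hother : ∀ j, j ≠ e → j ≠ i →
          actions (Function.update σ i τ') s j ≠ Action.vote (!X) := by
        intro j hje hji
        by_cases hjk : j = k
        · subst hjk; simp [hσk]
        · simp [hσj τ' s j hje hjk hji]
      refine votesFor_le_card fun j hj => ?_
      have hje : j ≠ e := by simpa using hj
      by_cases hji : j = i
      · subst hji
        have hact := hσi τ' s
        rw [hsi] at hact
        cases hact' : τ' x with
        | delegate l =>
          have hle : l ≠ e := by
            rintro rfl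
            exact hx (by rw [hact', hτ])
          have hlj : l ≠ j := by
            rintro rfl
            exact hfeas x hact'
          rw [castVote_of_delegate (hact.trans hact') (hnd τ' s l hlj)]
          exact hother l hle hlj
        | abstain =>
          rw [castVote_of_not_delegate] <;> simp [hact, hact']
        | vote Y =>
          rw [castVote_of_not_delegate (by simp [hact, hact']), hact]
          exact hX
      · rw [castVote_of_not_delegate (hnd τ' s j hji)]
        exact hother j hje hji
    exact h2.trans h1

theorem delegationProfile_isEquilibrium (hN : Odd (Fintype.card V)) {e : V} {q r : ℝ}
    (hq : 1 / 2 < q) (hqr : q < r) (hr : r < 1) {M : Finset V} (heM : e ∉ M)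
    (hM : IsOptimalSize (Fintype.card V) (expertWeight q r) M.card) :
    IsEquilibrium liquidDemocracy (singleExpertCommittee e q r) (delegationProfile e M) := by
  refine ⟨delegationProfile_isFeasible e M, fun i τ _ => ?_, fun i => ?_⟩
  · rw [expectedUtility_eq_correctProb, expectedUtility_eq_correctProb,
      correctProb_le_iff e q r e, funext (followProb_delegationProfile hN heM)]
    by_cases hi : i ∈ insert e M
    · refine value_le_of_isOptimalSize hq hqr hr heM hM (fun s => winProb_nonneg _ _)
        (fun s => winProb_le_one _ _)
        (followProb_dependsOnlyOn (mem_insert_self _ _) fun j hj => ?_)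
      rw [Function.update_of_ne (ne_of_mem_of_not_mem hi hj).symm,
        delegationProfile_delegatesTo hj, delegationProfile_delegatesTo hj]
    -- A deviating delegator may bring in her own signal, but cannot beat a hostile majority within
    -- `M`. Otherwise at most (N + 1) / 2 voters oppose `e`, and following her is still right.
    · have hiM : i ∉ M := fun h => hi (mem_insert_of_mem h)
      have hie : i ≠ e := fun h => hi (h ▸ mem_insert_self _ _)
      refine value_le_delegationRule hq hqr hr (M' := insert i M)
        (by simp [hie.symm, heM]) (subset_insert i M) (fun s => winProb_le_one _ _)
        (followProb_dependsOnlyOn (mem_insert_self _ _) fun j hj => ?_)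
        (fun s hs => followProb_eq_zero_of_majority (fun j hj => ?_) hs) fun s hs => ?_
      · simp only [mem_insert, not_or] at hj
        have hj' : j ∉ insert e M := by simp [hj.1, hj.2.2]
        rw [Function.update_of_ne hj.2.1, delegationProfile_delegatesTo hj',
          delegationProfile_delegatesTo hj']
      · rw [Function.update_of_ne (ne_of_mem_of_not_mem hj hiM)]
        exact delegationProfile_isSincere (mem_insert_of_mem hj)
      · have h1 : opposed e (insert i M) s ≤ opposed e M s + 1 := by
          rw [opposed_insert hiM]; split_ifs <;> omega
        have h2 : 2 * opposed e (insert i M) s ≤ Fintype.card V + 1 := by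
          obtain ⟨k, hk⟩ := hN
          omega
        have h3 : (2 * opposed e (insert i M) s : ℝ) ≤ (Fintype.card V : ℝ) + 1 := by
          exact_mod_cast h2
        have h4 := hM.le_weight
        rw [card_insert_of_notMem hiM]
        push_cast
        linarith
  · by_cases hi : i ∈ insert e M
    · exact sincere_not_isWeaklyDominated hq hqr hr (fun j => by simp [liquidDemocracy])
        (delegationProfile_isSincere hi)
    · have hie : i ≠ e := fun h => hi (h ▸ mem_insert_self _ _)
      -- A third voter exists because an odd committee cannot have exactly two members.
      obtain ⟨k, hk⟩ : ∃ k, k ∉ ({i, e} : Finset V) := by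
        by_contra! hall
        have h1 : Fintype.card V = 2 := by
          rw [← card_univ, ← eq_univ_of_forall hall, card_pair hie]
        rw [h1] at hN
        exact absurd hN (by decide)
      simp only [mem_insert, mem_singleton, not_or] at hk
      exact delegatesTo_not_isWeaklyDominated hq hqr hr hie hk.1 hk.2
        (delegationProfile_delegatesTo hi)

/-! ### Direct democracy and existence of best equilibria -/

theorem followProb_directDemocracy {σ : Profile V} {e : V}
    (hfeas : IsFeasibleProfile directDemocracy σ) (hσ : ∀ i, IsNeutral (σ i)) :
    ∃ k ≤ 1, followProb σ e = weightRule e k (sincereNonexperts σ e) := by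
  classical
  have hcount : ∀ s X, votesFor (actions σ s) X =
      ((univ.filter fun i => IsSincere (σ i)).filter fun i => s i = X).card := by
    intro s X
    rw [votesFor, filter_filter]
    congr 1
    refine filter_congr fun i _ => ?_
    rw [castVote_of_not_delegate (fun j => hfeas i (s i) j), actions]
    rcases hσ i with h | h | ⟨j, h⟩
    · simp [h, h (s i)]
    · have : ¬ IsSincere (σ i) := fun h' => by have := h' true; simp [h true] at this
      simp [h (s i), this]
    · exact absurd (h true) (hfeas i true j)
  have hM : ∀ s, ((sincereNonexperts σ e).filter fun i => s i = s e).card + opposed e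
      (sincereNonexperts σ e) s = (sincereNonexperts σ e).card := fun s =>
    card_filter_add_card_filter_not (s := sincereNonexperts σ e) (fun i => s i = s e)
  have hnot : ∀ s : V → Side, ∀ i, s i = !s e ↔ s i ≠ s e := by
    intro s i; cases s i <;> cases s e <;> simp
  have he := notMem_sincereNonexperts σ e
  by_cases hes : IsSincere (σ e)
  · have hS : (univ.filter fun i => IsSincere (σ i)) = insert e (sincereNonexperts σ e) := by
      ext i
      by_cases hi : i = e
      · simp [hi, hes]
      · simp [sincereNonexperts, hi]
    refine ⟨1, le_rfl, funext fun s => ?_⟩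
    have h1 := hcount s (s e)
    have h2 := hcount s (!s e)
    rw [hS, filter_insert, if_pos rfl, card_insert_of_notMem (by simp [he])] at h1
    rw [hS, filter_insert, if_neg (by simp), filter_congr fun i _ => hnot s i] at h2
    change _ = opposed e (sincereNonexperts σ e) s at h2
    have h3 := hM s
    unfold followProb winProb weightRule
    split_ifs <;> first | omega | rfl
  · have hS : (univ.filter fun i => IsSincere (σ i)) = sincereNonexperts σ e := by
      ext i
      by_cases hi : i = e
      · simp [hi, hes, sincereNonexperts]
      · simp [sincereNonexperts, hi]
    refine ⟨0, Nat.zero_le 1, funext fun s => ?_⟩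
    have h1 := hcount s (s e)
    have h2 := hcount s (!s e)
    rw [hS] at h1
    rw [hS, filter_congr fun i _ => hnot s i] at h2
    change _ = opposed e (sincereNonexperts σ e) s at h2
    have h3 := hM s
    unfold followProb winProb weightRule
    split_ifs <;> first | omega | rfl

/-- The profile in which `e` votes sincerely and all others abstain. -/
def expertOnlyProfile (e : V) : Profile V := fun i s =>
  if i = e then Action.vote s else Action.abstain

theorem followProb_expertOnlyProfile (e : V) (s : V → Side) :
    followProb (expertOnlyProfile e) e s = 1 := by
  refine winProb_eq_one ?_
  have h1 : votesFor (actions (expertOnlyProfile e) s) (!s e) = 0 := by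
    refine votesFor_eq_zero fun j => ?_
    by_cases hj : j = e
    · subst hj
      simp [actions, expertOnlyProfile]
    · simp [actions, expertOnlyProfile, hj]
  have h2 : 1 ≤ votesFor (actions (expertOnlyProfile e) s) (s e) := by
    rw [← card_singleton e]
    refine card_le_votesFor fun j hj => ?_
    rw [mem_singleton.1 hj, castVote_of_not_delegate] <;> simp [actions, expertOnlyProfile]
  omega

omit [Fintype V] in
theorem expertOnlyProfile_update_const {e i : V} {τ : Strategy V} {j : V} (hje : j ≠ e)
    (hji : j ≠ i) : Function.update (expertOnlyProfile e) i τ j true =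
      Function.update (expertOnlyProfile e) i τ j false := by
  rw [Function.update_of_ne hji]
  simp [expertOnlyProfile, hje]

omit [Fintype V] in
theorem expertOnlyProfile_isFeasible (e : V) :
    IsFeasibleProfile directDemocracy (expertOnlyProfile e) := by
  intro i s j
  unfold expertOnlyProfile
  split_ifs <;> simp

/-- When only `e` votes, a vote by `i` can at best leave her decision alone and at some signals ties
it, while her signal outweighs that of `i`. -/
theorem abstain_not_isWeaklyDominated {e : V} {q r : ℝ} (hq : 1 / 2 < q) (hqr : q < r)
    (hr : r < 1) {i : V} (hie : i ≠ e) :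
    ¬ IsWeaklyDominated directDemocracy (singleExpertCommittee e q r) i
      (expertOnlyProfile e i) := by
  refine not_isWeaklyDominated fun τ' hfeas ⟨x, hx⟩ =>
    ⟨expertOnlyProfile e, expertOnlyProfile_isFeasible e, ?_⟩
  rw [Function.update_eq_self]
  obtain ⟨Y, hY⟩ : ∃ Y, τ' x = Action.vote Y := by
    cases h : τ' x with
    | vote Y => exact ⟨Y, rfl⟩
    | abstain => exact absurd h (by simpa [expertOnlyProfile, hie] using hx)
    | delegate j => exact absurd h (hfeas x j)
  refine correctProb_lt_of_followProb_eq_one (mem_insert_self e {i})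
    (advantage_pair_pos hq hqr hr hie)
    (fun j hj => expertOnlyProfile_update_const (fun h => hj (by simp [h]))
      (fun h => hj (by simp [h])))
    (followProb_expertOnlyProfile e) (s₀ := fun j => if j = e then !Y else x) ?_
  refine winProb_lt_one ?_
  simp only [if_true]
  set s : V → Side := fun j => if j = e then !Y else x
  have hsi : s i = x := if_neg hie
  have hi : actions (Function.update (expertOnlyProfile e) i τ') s i = Action.vote Y := by
    simp [actions, hsi, hY]
  have h1 : 1 ≤ votesFor (actions (Function.update (expertOnlyProfile e) i τ') s) (!!Y) := by
    rw [← card_singleton i, Bool.not_not]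
    refine card_le_votesFor fun j hj => ?_
    rw [mem_singleton.1 hj, castVote_of_not_delegate (by simp [hi]), hi]
  have h2 : votesFor (actions (Function.update (expertOnlyProfile e) i τ') s) (!Y) ≤ 1 := by
    rw [← card_singleton e]
    refine votesFor_le_card fun j hj => ?_
    have hje : j ≠ e := by simpa using hj
    by_cases hji : j = i
    · subst hji
      rw [castVote_of_not_delegate (by simp [hi]), hi]
      simp
    · have : actions (Function.update (expertOnlyProfile e) i τ') s j = Action.abstain := by
        simp [actions, hji, expertOnlyProfile, hje]
      rw [castVote_of_not_delegate (by simp [this]), this]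
      simp
  exact h2.trans h1

/-- This equilibrium serves to make the finite set of neutral equilibria nonempty. A deviation uses
at most one signal besides the expert's, too little to overturn hers. -/
theorem expertOnlyProfile_isNeutralEquilibrium (e : V) {q r : ℝ} (hq : 1 / 2 < q) (hqr : q < r)
    (hr : r < 1) :
    IsNeutralEquilibrium directDemocracy (singleExpertCommittee e q r) (expertOnlyProfile e) := by
  refine ⟨⟨expertOnlyProfile_isFeasible e, fun i τ _ => ?_, fun i => ?_⟩, fun i => ?_⟩
  · rw [expectedUtility_eq_correctProb, expectedUtility_eq_correctProb]
    by_cases hi : i = e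
    · subst hi
      exact correctProb_le_of_followProb_eq_one (mem_singleton_self i)
        (advantage_singleton_pos hq hqr hr i)
        (fun j hj => expertOnlyProfile_update_const (by simpa using hj) (by simpa using hj))
        (followProb_expertOnlyProfile i)
    · exact correctProb_le_of_followProb_eq_one (mem_insert_self e {i})
        (advantage_pair_pos hq hqr hr hi)
        (fun j hj => expertOnlyProfile_update_const (fun h => hj (by simp [h]))
          (fun h => hj (by simp [h])))
        (followProb_expertOnlyProfile e)
  · by_cases hi : i = e
    · exact sincere_not_isWeaklyDominated hq hqr hr (fun j => by simp [directDemocracy])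
        fun s => by simp [expertOnlyProfile, hi]
    · exact abstain_not_isWeaklyDominated hq hqr hr hi
  · by_cases hi : i = e
    · exact Or.inl fun s => by simp [expertOnlyProfile, hi]
    · exact Or.inr (Or.inl fun s => by simp [expertOnlyProfile, hi])

omit [DecidableEq V] in
theorem finite_action : Finite (Action V) :=
  Finite.of_surjective (α := Side ⊕ Option V)
    (fun x => match x with
      | .inl X => Action.vote X
      | .inr none => Action.abstain
      | .inr (some j) => Action.delegate j)
    fun a => match a with
      | .vote X => ⟨.inl X, rfl⟩
      | .abstain => ⟨.inr none, rfl⟩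
      | .delegate j => ⟨.inr (some j), rfl⟩

theorem exists_isBestNeutralEquilibrium {M : Mechanism V} {C : Committee V} {σ : Profile V}
    (hσ : IsNeutralEquilibrium M C σ) : ∃ τ, IsBestNeutralEquilibrium M C τ := by
  have := finite_action (V := V)
  obtain ⟨τ, hτ, hmax⟩ := Set.exists_max_image {σ | IsNeutralEquilibrium M C σ} (correctProb C)
    (Set.toFinite _) ⟨σ, hσ⟩
  exact ⟨τ, hτ, hmax⟩

theorem correctProb_le_delegationProfile (hN : Odd (Fintype.card V)) {e : V} {q r : ℝ}
    {M : Finset V} (heM : e ∉ M)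
    (hbest : ∀ (M' : Finset V) (φ : (V → Side) → ℝ), e ∉ M' → IsAdmissible e M' φ →
      value (singleExpertCommittee e q r) e φ ≤
        value (singleExpertCommittee e q r) e (delegationRule e M))
    {σ : Profile V} (hσ : ∀ i, IsNeutral (σ i)) :
    correctProb (singleExpertCommittee e q r) σ ≤
      correctProb (singleExpertCommittee e q r) (delegationProfile e M) := by
  rw [correctProb_le_iff e q r e, funext (followProb_delegationProfile hN heM)]
  exact hbest _ _ (notMem_sincereNonexperts σ e) (followProb_isAdmissible hσ e)

/-- The minimum is the number of votes cast by `e`. Uncapped, it is the floor of `W`; capped, it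
leaves fewer than half of the votes to the others. -/
theorem isOptimalSize_sub_min {N : ℕ} (hN : Odd N) {W : ℝ} (hW : 1 ≤ W) :
    IsOptimalSize N W (N - min ⌊W⌋₊ ((N + 1) / 2)) := by
  obtain ⟨k, rfl⟩ := hN
  have hfl : 1 ≤ ⌊W⌋₊ := Nat.le_floor (by simpa using hW)
  have h1 : (⌊W⌋₊ : ℝ) ≤ W := Nat.floor_le (by linarith)
  have h2 : W < ⌊W⌋₊ + 1 := Nat.lt_floor_add_one W
  have h3 : ((min ⌊W⌋₊ ((2 * k + 1 + 1) / 2) : ℕ) : ℝ) ≤ ⌊W⌋₊ := by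
    exact_mod_cast min_le_left _ _
  have h4 : ((2 * k + 1 - min ⌊W⌋₊ ((2 * k + 1 + 1) / 2) : ℕ) : ℝ) =
      (2 * k + 1 : ℕ) - (min ⌊W⌋₊ ((2 * k + 1 + 1) / 2) : ℕ) := by
    rw [Nat.cast_sub (by omega)]
  refine ⟨by omega, by linarith, ?_⟩
  rcases le_total ⌊W⌋₊ ((2 * k + 1 + 1) / 2) with h | h
  · left
    rw [min_eq_left h] at h4 ⊢
    linarith
  · right
    rw [min_eq_right h]
    omega

end Voting

end VoteDelegation

/-! ### Assembly of the main theorem -/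

theorem mainTheorem4 {V : Type*} [Fintype V] [DecidableEq V] (e : V)
    (hN : Odd (Fintype.card V)) (q r : ℝ) (hq : 1 / 2 < q) (hqr : q < r) (hr : r < 1) :
    (∃ σ : VoteDelegation.Profile V,
      VoteDelegation.IsBestNeutralEquilibrium VoteDelegation.liquidDemocracy
        (VoteDelegation.singleExpertCommittee e q r) σ ∧
      (VoteDelegation.expertWeight q r < 2 → ∀ i, VoteDelegation.IsSincere (σ i)) ∧
      (2 ≤ VoteDelegation.expertWeight q r →
        ∃ D : Finset V, e ∉ D ∧
          D.card = min (⌊VoteDelegation.expertWeight q r⌋₊ - 1) ((Fintype.card V - 1) / 2) ∧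
          (∀ i ∈ D, VoteDelegation.DelegatesTo (σ i) e) ∧
          ∀ i ∉ D, VoteDelegation.IsSincere (σ i))) ∧
    (∃ τ : VoteDelegation.Profile V,
      VoteDelegation.IsBestNeutralEquilibrium VoteDelegation.directDemocracy
        (VoteDelegation.singleExpertCommittee e q r) τ) ∧
    (2 < VoteDelegation.expertWeight q r →
      VoteDelegation.expertWeight q r < ((Fintype.card V : ℝ) + 1) / 2 →
      ∀ σ τ : VoteDelegation.Profile V,
        VoteDelegation.IsBestNeutralEquilibrium VoteDelegation.liquidDemocracy
          (VoteDelegation.singleExpertCommittee e q r) σ →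
        VoteDelegation.IsBestNeutralEquilibrium VoteDelegation.directDemocracy
          (VoteDelegation.singleExpertCommittee e q r) τ →
        VoteDelegation.correctProb (VoteDelegation.singleExpertCommittee e q r) τ <
          VoteDelegation.correctProb (VoteDelegation.singleExpertCommittee e q r) σ) := by
  set W := VoteDelegation.expertWeight q r
  have hW1 : 1 < W := VoteDelegation.one_lt_expertWeight hq hqr hr
  set m := Fintype.card V - min ⌊W⌋₊ ((Fintype.card V + 1) / 2)
  have hopt : VoteDelegation.IsOptimalSize (Fintype.card V) W m :=
    VoteDelegation.isOptimalSize_sub_min hN hW1.le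
  obtain ⟨M, heM, hcard, hbest⟩ :=
    VoteDelegation.exists_best_delegationRule e hN hq hqr hr hopt
  have hoptM : VoteDelegation.IsOptimalSize (Fintype.card V) W M.card := hcard ▸ hopt
  -- One less than the votes cast by `e`, since one of them is her own.
  have hD : (insert e M)ᶜ.card = min (⌊W⌋₊ - 1) ((Fintype.card V - 1) / 2) := by
    have hfl : 1 ≤ ⌊W⌋₊ := Nat.le_floor (by simpa using hW1.le)
    obtain ⟨k, hk⟩ := hN
    rw [Finset.card_compl, Finset.card_insert_of_notMem heM, hcard]
    omega
  have heq : VoteDelegation.IsNeutralEquilibrium VoteDelegation.liquidDemocracy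
      (VoteDelegation.singleExpertCommittee e q r) (VoteDelegation.delegationProfile e M) :=
    ⟨VoteDelegation.delegationProfile_isEquilibrium hN hq hqr hr heM hoptM,
      VoteDelegation.delegationProfile_isNeutral e M⟩
  refine ⟨⟨VoteDelegation.delegationProfile e M, ⟨heq, fun σ hσ =>
      VoteDelegation.correctProb_le_delegationProfile hN heM hbest hσ.2⟩, fun hW i => ?_,
      fun _ => ⟨(insert e M)ᶜ, by simp, hD, fun i hi => ?_, fun i hi => ?_⟩⟩,
    VoteDelegation.exists_isBestNeutralEquilibrium
      (VoteDelegation.expertOnlyProfile_isNeutralEquilibrium e hq hqr hr),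
    fun hW2 hWN σ τ hσ hτ => ?_⟩
  -- Here the floor is one, so nobody delegates and the profile is fully sincere.
  · have hfl : ⌊W⌋₊ < 2 := (Nat.floor_lt (by linarith)).2 (by exact_mod_cast hW)
    have hempty : (insert e M)ᶜ = ∅ := Finset.card_eq_zero.1 (by rw [hD]; omega)
    refine VoteDelegation.delegationProfile_isSincere ?_
    by_contra hi
    have := Finset.mem_compl.2 hi
    simp [hempty] at this
  · exact VoteDelegation.delegationProfile_delegatesTo (Finset.mem_compl.1 hi)
  · exact VoteDelegation.delegationProfile_isSincere (by rwa [Finset.mem_compl, not_not] at hi)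
  · refine lt_of_lt_of_le ?_ (hσ.2 _ heq)
    obtain ⟨k, hk, hfollow⟩ := VoteDelegation.followProb_directDemocracy (e := e) hτ.1.1.1 hτ.1.2
    rw [VoteDelegation.correctProb_lt_iff e q r e, hfollow,
      funext (VoteDelegation.followProb_delegationProfile hN heM)]
    -- The upper bound on `W` yields N < 2m + 1, and parity improves this to N < 2m: the voters in
    -- `M` can overrule `e`.
    have hbig : Fintype.card V < 2 * M.card := by
      have h1 := hopt.le_weight
      have h2 : (Fintype.card V : ℝ) < 2 * m + 1 := by linarith
      have h3 : Fintype.card V < 2 * m + 1 := by exact_mod_cast h2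
      obtain ⟨l, hl⟩ := hN
      omega
    exact VoteDelegation.weightRule_le_one_lt_delegationRule hN hq hqr hr hW2 heM hoptM hbig hbest
      (VoteDelegation.notMem_sincereNonexperts τ e) hk
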